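/- Let $k\ge 3$ and $d\ge 0$ be integers. There exist constants $0<C_{k,d,1}\le C_{k,d,2}<\infty$, depending only on $k$ and $d$, such that the following holds for all integers $n\ge 2$ and $m\ge 0$ with $nd=mk$. Let $V$ be a set of $n$ variables and $F$ a set of $m$ clauses. Attach $d$ half-edges to every variable and $k$ half-edges to every clause, and let $\boldsymbol{E}$ be a uniformly random perfect matching between the $nd$ variable half-edges and the $mk$ clause half-edges (the configuration model $\boldsymbol{G}=(V,F,\boldsymbol{E})$; multi-edges are allowed). For an edge $e$ let $v(e)$ be its variable. Given literals $\mathtt{L}=(\mathtt{L}_e)_{e\in \boldsymbol{E}}\in\{0,1\}^{\boldsymbol{E}}$, call $x\in\{0,1\}^V$ a NAE-SAT solution of $(\boldsymbol{G},\mathtt{L})$ if for every clause $a\in F$ the $k$ values $x_{v(e)}\oplus \mathtt{L}_e$, over the edges $e$ at $a$, are not all equal; call $x$ a 2-coloring of $\boldsymbol{G}$ if it is a NAE-SAT solution with all literals equal to $0$. Let $Z_{\mathrm{COL}}$ be the number of 2-colorings of $\boldsymbol{G}$, and let $Z_{\mathrm{NAE}}$ be the number of NAE-SAT solutions of $(\boldsymbol{G},\mathbf{L})$,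 where the literals $\mathbf{L}_e$ are i.i.d. uniform on $\{0,1\}$ and independent of $\boldsymbol{E}$. Then $$\mathbb{E} Z_{\mathrm{NAE}}=2^n\bigl(1-2^{-k+1}\bigr)^m\qquad\text{and}\qquad \frac{\mathbb{E} Z_{\mathrm{COL}}}{\mathbb{E} Z_{\mathrm{NAE}}}\in\bigl[C_{k,d,1},\,C_{k,d,2}\bigr].$$ -/

import Mathlib

namespace RegularNAE

/-- An outcome of the configuration model with `n` variables carrying `d` half-edges each and `m`
clauses carrying `k` half-edges each: a perfect matching between the clause half-edges
`Fin m × Fin k` and the variable half-edges `Fin n × Fin d`.  Multi-edges are allowed.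
Edges are labelled by their clause half-edge: `(a, i)` is the `i`-th edge at the clause `a`. -/
abbrev Matching (n m d k : ℕ) : Type := (Fin m × Fin k) ≃ (Fin n × Fin d)

/-- The variable `v(e)` incident to the edge `e`. -/
def Matching.variable {n m d k : ℕ} (E : Matching n m d k) (e : Fin m × Fin k) : Fin n :=
  (E e).1

/-- An assignment of a literal in `{0,1}` to every edge. -/
abbrev Literals (m k : ℕ) : Type := Fin m × Fin k → Bool

/-- The entries of `z ∈ {0,1}^k` are not all equal. -/
def NotAllEqual {k : ℕ} (z : Fin k → Bool) : Prop := ¬ ∀ i j, z i = z j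

/-- `x ∈ {0,1}^V` is a solution of the NAE-SAT instance `(E, L)`: in every clause `a` the values
`x_{v(e)} ⊕ L_e`, for `e` ranging over the `k` edges at `a`, are not all equal. -/
def IsNAESolution {n m d k : ℕ} (E : Matching n m d k) (L : Literals m k) (x : Fin n → Bool) :
    Prop :=
  ∀ a : Fin m, NotAllEqual fun i : Fin k => xor (x (E.variable (a, i))) (L (a, i))

/-- `x ∈ {0,1}^V` is a (hypergraph) 2-coloring: a NAE-SAT solution when all literals are zero. -/
def IsTwoColoring {n m d k : ℕ} (E : Matching n m d k) (x : Fin n → Bool) : Prop :=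
  IsNAESolution E (fun _ => false) x

/-- The number of 2-colorings. -/
noncomputable def numColorings {n m d k : ℕ} (E : Matching n m d k) : ℕ :=
  Nat.card {x : Fin n → Bool // IsTwoColoring E x}

/-- The number of NAE-SAT solutions. -/
noncomputable def numNAESolutions {n m d k : ℕ} (E : Matching n m d k) (L : Literals m k) : ℕ :=
  Nat.card {x : Fin n → Bool // IsNAESolution E L x}

/-- `𝔼 Z_COL`: the expected number of 2-colorings, for a uniformly random matching
(`Finset.expect` is the average over a finite set). -/
noncomputable def expectedColorings (n m d k : ℕ) : ℝ :=
  Finset.expect (Finset.univ : Finset (Matching n m d k)) fun E => (numColorings E : ℝ)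

/-- `𝔼 Z_NAE`: the expected number of NAE-SAT solutions, for a uniformly random matching and
independent i.i.d. uniform literals, i.e. for a uniformly random pair (matching, literals). -/
noncomputable def expectedNAESolutions (n m d k : ℕ) : ℝ :=
  Finset.expect (Finset.univ : Finset (Matching n m d k × Literals m k)) fun G =>
    (numNAESolutions G.1 G.2 : ℝ)

end RegularNAE

/-! ### Both expectations in terms of colourings of clause half-edges -/

namespace RegularNAE

open Finset

/-! Write N = nd = mk, W = 2^k - 2, and A(j) = `properCount m k j`. A vertex colouring with s ones
induces, through the random matching, a uniformly random set of sd clause half-edges, so E Z_COL is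
the sum over s of C(n,s) A(sd) / C(N,sd). Random literals instead make the half-edge colours
independent and uniform, so E Z_NAE = 2^n W^m / 2^N.

Upper bound (`exists_properCount_le`): A(j)/C(N,j) ≤ K W^m/2^N for every j. A(j) is a coefficient of
an m-th power of a one-clause polynomial. Tilting the colours to density p = j/N makes j the mean of
the corresponding binomial law, whose mass there is at least of order 1/√N
(`pow_self_le_choose_mul`). Anticoncentration (`coeff_pow_le`) bounds the tilted coefficient by (1 -
p^k - q^k)^m times order 1/√m, where q = 1 - p. The square roots cancel up to a constant, and
convexity gives 1 - p^k - q^k ≤ W/2^k.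

Lower bound (`le_expectedColorings`): C(n,s)/C(N,sd) is at least a constant times 2^n/2^N times a
Gaussian factor in s - n/2, so it suffices that enough of the total mass W^m of A lies on multiples
of d and near N/2. At least W^m/W^d lies on multiples of d (`pow_le_sum_properCount_dvd`), by using
d clauses to correct the residue. The upper bound already proved dominates A by a binomial law, so
its second moment about N/2 is O(N W^m), which controls the Gaussian factor. -/

/-- The number of entries of a Boolean vector that are `true`. -/
def ones {ι : Type*} [Fintype ι] (w : ι → Bool) : ℕ := #{e | w e = true}

/-- Every clause sees both colours in the colouring `w` of the clause half-edges. -/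
def IsProper {m k : ℕ} (w : Fin m × Fin k → Bool) : Prop :=
  ∀ a : Fin m, NotAllEqual fun i : Fin k => w (a, i)

open scoped Classical in
/-- The number of proper colourings of the clause half-edges with `j` entries `true`. -/
noncomputable def properCount (m k j : ℕ) : ℕ :=
  #{w : Fin m × Fin k → Bool | IsProper w ∧ ones w = j}

theorem ones_le_card {ι : Type*} [Fintype ι] (w : ι → Bool) : ones w ≤ Fintype.card ι :=
  Finset.card_le_univ _

theorem sum_apply_ones {ι R : Type*} [Fintype ι] [DecidableEq ι] [CommSemiring R] (F : ℕ → R) :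
    ∑ x : ι → Bool, F (ones x)
      = ∑ s ∈ range (Fintype.card ι + 1), ((Fintype.card ι).choose s : R) * F s := by
  have h := Finset.sum_powerset_apply_card F (x := (univ : Finset ι))
  simp only [nsmul_eq_mul, Finset.card_univ] at h
  rw [← h]
  refine Finset.sum_nbij' (fun x => univ.filter fun e => x e = true) (fun s e => decide (e ∈ s))
    ?_ ?_ ?_ ?_ ?_
  · simp
  · simp
  · intro x _
    ext e
    simp
  · intro s _
    ext e
    simp
  · intro x _
    rfl

theorem card_fiber_true {ι : Type*} [Fintype ι] (w : ι → Bool) :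
    Fintype.card {e // w e = true} = ones w := by
  rw [Fintype.card_subtype]
  rfl

theorem card_fiber_false {ι : Type*} [Fintype ι] (w : ι → Bool) :
    Fintype.card {e // w e = false} = Fintype.card ι - ones w := by
  have h := Fintype.card_subtype_compl fun e => w e = true
  rw [card_fiber_true] at h
  rw [← h]
  exact Fintype.card_congr (Equiv.subtypeEquivRight fun e => by simp)

theorem ones_comp_equiv {α β : Type*} [Fintype α] [Fintype β] (E : α ≃ β) (f : β → Bool) :
    ones (f ∘ E) = ones f := by
  rw [← card_fiber_true, ← card_fiber_true]
  exact Fintype.card_congr (E.subtypeEquiv fun a => Iff.rfl)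

/-- Once one bijection `E₀` carries `f` to `w`, all others differ from it by a permutation
stabilizing `f`, and that stabilizer is a product of two symmetric groups. -/
theorem card_equiv_comp_eq {α β : Type*} [Fintype α] [Fintype β] [DecidableEq α] [DecidableEq β]
    (hc : Fintype.card α = Fintype.card β) (f : β → Bool) (w : α → Bool) :
    #{E : α ≃ β | f ∘ E = w}
      = if ones w = ones f then (ones f).factorial * (Fintype.card β - ones f).factorial
        else 0 := by
  split_ifs with h
  · have e : ∀ c, Nonempty ({a // w a = c} ≃ {b // f b = c}) := by
      intro c
      rw [← Fintype.card_eq]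
      cases c
      · rw [card_fiber_false, card_fiber_false, h, hc]
      · rw [card_fiber_true, card_fiber_true, h]
    set E₀ : α ≃ β := Equiv.ofFiberEquiv fun c => (e c).some with hE₀
    have hE : ∀ a, f (E₀ a) = w a := fun a => Equiv.ofFiberEquiv_map _ a
    have hs := DomMulAct.stabilizer_card f
    rw [Fintype.prod_bool, card_fiber_true, card_fiber_false] at hs
    rw [← hs, ← Fintype.card_subtype]
    refine Fintype.card_congr
      { toFun := fun E => ⟨E₀.symm.trans E.1, ?_⟩
        invFun := fun g => ⟨E₀.trans g.1, ?_⟩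
        left_inv := fun E => by ext; simp
        right_inv := fun g => by ext; simp }
    · ext b
      have := congrFun E.2 (E₀.symm b)
      simp only [Function.comp_apply] at this
      simp [this, ← hE]
    · ext a
      have := congrFun g.2 (E₀ a)
      simp only [Function.comp_apply] at this
      simp [this, hE]
  · rw [Finset.card_eq_zero, Finset.filter_eq_empty_iff]
    rintro E - rfl
    exact h (ones_comp_equiv E f)

theorem isTwoColoring_iff {n m d k : ℕ} (E : Matching n m d k) (x : Fin n → Bool) :
    IsTwoColoring E x ↔ IsProper ((fun v : Fin n × Fin d => x v.1) ∘ E) := by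
  simp [IsTwoColoring, IsNAESolution, IsProper, Matching.variable]

theorem ones_comp_fst {n d : ℕ} (x : Fin n → Bool) :
    ones (fun v : Fin n × Fin d => x v.1) = ones x * d := by
  unfold ones
  have : (univ.filter fun v : Fin n × Fin d => x v.1 = true)
      = (univ.filter fun v : Fin n => x v = true) ×ˢ (univ : Finset (Fin d)) := by
    ext v
    simp
  rw [this, Finset.card_product, Finset.card_univ, Fintype.card_fin]

open scoped Classical in
-- Matchings are grouped by the half-edge colouring they induce; every proper colouring with the
-- right number of ones arises from equally many.
theorem card_matchings_twoColoring {n m d k : ℕ} (h : n * d = m * k) (x : Fin n → Bool) :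
    #{E : Matching n m d k | IsTwoColoring E x}
      = properCount m k (ones x * d)
        * ((ones x * d).factorial * (n * d - ones x * d).factorial) := by
  set f : Fin n × Fin d → Bool := fun v => x v.1 with hf
  have hc : Fintype.card (Fin m × Fin k) = Fintype.card (Fin n × Fin d) := by simp [h]
  have hfo : ones f = ones x * d := ones_comp_fst x
  have hfib : ∀ E ∈ (univ.filter fun E : Matching n m d k => IsTwoColoring E x),
      f ∘ E ∈ (univ.filter fun w : Fin m × Fin k → Bool => IsProper w ∧ ones w = ones x * d) := by
    intro E hE
    simp only [mem_filter, mem_univ, true_and] at hE ⊢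
    exact ⟨(isTwoColoring_iff E x).1 hE, (ones_comp_equiv E f).trans hfo⟩
  rw [Finset.card_eq_sum_card_fiberwise hfib, properCount, Finset.card_eq_sum_ones, Finset.sum_mul]
  refine Finset.sum_congr rfl fun w hw => ?_
  rw [one_mul]
  simp only [mem_filter, mem_univ, true_and] at hw
  have := card_equiv_comp_eq hc f w
  rw [if_pos (hw.2.trans hfo.symm), hfo] at this
  simp only [Fintype.card_prod, Fintype.card_fin] at this
  rw [← this, Finset.filter_filter]
  congr 1
  ext E
  simp only [mem_filter, mem_univ, true_and]
  constructor
  · exact fun h => h.2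
  · rintro rfl
    exact ⟨(isTwoColoring_iff E x).2 hw.1, rfl⟩

theorem card_matching {n m d k : ℕ} (h : n * d = m * k) :
    Fintype.card (Matching n m d k) = (n * d).factorial := by
  have e : (Fin m × Fin k) ≃ (Fin n × Fin d) := Fintype.equivOfCardEq (by simp [h])
  rw [Fintype.card_equiv e]
  simp [h]

theorem expectedColorings_eq {n m d k : ℕ} (h : n * d = m * k) :
    expectedColorings n m d k
      = ∑ s ∈ range (n + 1),
          (n.choose s : ℝ) * (properCount m k (s * d) / (n * d).choose (s * d)) := by
  classical
  have h1 : ∑ E : Matching n m d k, (numColorings E : ℝ)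
      = ∑ x : Fin n → Bool, (#{E : Matching n m d k | IsTwoColoring E x} : ℝ) := by
    simp only [numColorings, Nat.card_eq_fintype_card, Fintype.card_subtype, Finset.card_filter,
      Nat.cast_sum]
    exact Finset.sum_comm
  have h2 := sum_apply_ones (ι := Fin n) (fun s => ((properCount m k (s * d) : ℝ)
    * ((s * d).factorial * (n * d - s * d).factorial)) / (n * d).factorial)
  rw [expectedColorings, Finset.expect_eq_sum_div_card, h1, Finset.card_univ, card_matching h,
    Finset.sum_div]
  simp only [card_matchings_twoColoring h, Nat.cast_mul]
  rw [h2, Fintype.card_fin]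
  refine Finset.sum_congr rfl fun s hs => ?_
  have hs' : s * d ≤ n * d := Nat.mul_le_mul_right _ (Nat.lt_succ_iff.1 (mem_range.1 hs))
  rw [Nat.cast_choose ℝ hs']
  have := Nat.factorial_ne_zero (n * d)
  have := Nat.factorial_ne_zero (s * d)
  have := Nat.factorial_ne_zero (n * d - s * d)
  field_simp

open scoped Classical in
-- For fixed `E` and `x`, XOR with the edge values of `x` is an involution exchanging literals and
-- half-edge colourings.
theorem card_literals_solution {n m d k : ℕ} (E : Matching n m d k) (x : Fin n → Bool) :
    #{L : Literals m k | IsNAESolution E L x}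
      = #{w : Fin m × Fin k → Bool | IsProper w} := by
  refine Finset.card_nbij' (fun L e => xor (x (E.variable e)) (L e))
    (fun L e => xor (x (E.variable e)) (L e)) ?_ ?_ ?_ ?_
  · intro L hL
    simp only [coe_filter, mem_univ, true_and, Set.mem_ofPred_eq] at hL ⊢
    simpa [IsProper, IsNAESolution] using hL
  · intro L hL
    simp only [coe_filter, mem_univ, true_and, Set.mem_ofPred_eq] at hL ⊢
    simpa [IsProper, IsNAESolution] using hL
  · intro L _
    ext e
    simp
  · intro L _
    ext e
    simp

open scoped Classical in
theorem expectedNAESolutions_eq {n m d k : ℕ} (h : n * d = m * k) :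
    expectedNAESolutions n m d k
      = 2 ^ n * ((#{w : Fin m × Fin k → Bool | IsProper w} : ℝ) / 2 ^ (m * k)) := by
  have h1 : ∑ G : Matching n m d k × Literals m k, (numNAESolutions G.1 G.2 : ℝ)
      = ∑ E : Matching n m d k, ∑ x : Fin n → Bool,
        (#{L : Literals m k | IsNAESolution E L x} : ℝ) := by
    rw [Fintype.sum_prod_type]
    simp only [numNAESolutions, Nat.card_eq_fintype_card, Fintype.card_subtype, Finset.card_filter,
      Nat.cast_sum]
    exact Finset.sum_congr rfl fun E _ => Finset.sum_comm
  rw [expectedNAESolutions, Finset.expect_eq_sum_div_card, h1, Finset.card_univ,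
    Fintype.card_prod, card_matching h]
  simp only [card_literals_solution, Finset.sum_const, Finset.card_univ, card_matching h,
    Fintype.card_fun, Fintype.card_bool, Fintype.card_fin, Fintype.card_prod, nsmul_eq_mul]
  have := Nat.factorial_ne_zero (n * d)
  push_cast
  field_simp

end RegularNAE

/-! ### The clause generating polynomial -/

namespace RegularNAE

open Finset Polynomial

open scoped Classical in
theorem sum_notAllEqual_prod {R : Type*} [CommRing R] {k : ℕ} (hk : 1 ≤ k) (a b : R) :
    ∑ y : Fin k → Bool with NotAllEqual y, ∏ i, (if y i then a else b)
      = (a + b) ^ k - a ^ k - b ^ k := by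
  have hall : ∑ y : Fin k → Bool, ∏ i, (if y i then a else b) = (a + b) ^ k := by
    have := (Finset.prod_univ_sum (fun _ : Fin k => (univ : Finset Bool))
      (fun _ c => if c = true then a else b)).symm
    simpa only [Fintype.piFinset_univ, Fintype.sum_bool, if_true, Bool.false_eq_true, if_false,
      Finset.prod_const, Finset.card_univ, Fintype.card_fin] using this
  -- Only the two constant vectors are excluded; they are distinct because `k` is positive.
  have hcompl : (univ.filter fun y : Fin k → Bool => ¬ NotAllEqual y)
      = {fun _ => true, fun _ => false} := by
    ext y
    simp only [mem_filter, mem_univ, true_and, NotAllEqual, not_not, mem_insert, mem_singleton]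
    constructor
    · intro h
      cases h0 : y ⟨0, hk⟩
      · exact Or.inr (funext fun i => (h i _).trans h0)
      · exact Or.inl (funext fun i => (h i _).trans h0)
    · rintro (rfl | rfl) i j <;> rfl
  have hne : (fun _ : Fin k => true) ≠ fun _ => false := fun h => by
    simpa using congrFun h ⟨0, hk⟩
  have hsplit := Finset.sum_filter_add_sum_filter_not (univ : Finset (Fin k → Bool))
    NotAllEqual (fun y => ∏ i, (if y i then a else b))
  rw [hcompl, Finset.sum_pair hne, hall] at hsplit
  simp only [if_true, Bool.false_eq_true, if_false, Finset.prod_const, Finset.card_univ,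
    Fintype.card_fin] at hsplit
  rw [← hsplit]
  ring

open scoped Classical in
theorem sum_isProper_prod {R : Type*} [CommRing R] {m k : ℕ} (hk : 1 ≤ k) (a b : R) :
    ∑ w : Fin m × Fin k → Bool with IsProper w, ∏ e, (if w e then a else b)
      = ((a + b) ^ k - a ^ k - b ^ k) ^ m := by
  have h := Finset.prod_univ_sum
    (fun _ : Fin m => univ.filter fun y : Fin k → Bool => NotAllEqual y)
    (fun _ y => ∏ i, (if y i then a else b))
  simp only [sum_notAllEqual_prod hk, Finset.prod_const, Finset.card_univ, Fintype.card_fin] at h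
  rw [h]
  refine Finset.sum_nbij' (fun w a i => w (a, i)) (fun v e => v e.1 e.2) ?_ ?_ ?_ ?_ ?_
  · intro w hw
    simp only [mem_filter, mem_univ, true_and, Fintype.mem_piFinset] at hw ⊢
    exact hw
  · intro v hv
    simp only [mem_filter, mem_univ, true_and, Fintype.mem_piFinset] at hv ⊢
    exact hv
  · intro w _
    rfl
  · intro v _
    rfl
  · intro w _
    exact Fintype.prod_prod_type _

theorem prod_ite_eq_pow_ones {ι R : Type*} [Fintype ι] [CommSemiring R] (a b : R)
    (w : ι → Bool) :
    ∏ e, (if w e then a else b) = a ^ ones w * b ^ (Fintype.card ι - ones w) := by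
  classical
  rw [Finset.prod_ite, Finset.prod_const, Finset.prod_const, ← card_fiber_false,
    Fintype.card_subtype]
  simp [ones]

open scoped Classical in
theorem card_isProper {m k : ℕ} (hk : 1 ≤ k) :
    (#{w : Fin m × Fin k → Bool | IsProper w} : ℝ) = (2 ^ k - 2) ^ m := by
  have h := sum_isProper_prod (m := m) hk (1 : ℝ) 1
  simp only [ite_self, Finset.prod_const_one, Finset.sum_const, nsmul_eq_mul, mul_one,
    one_pow] at h
  rw [h]
  norm_num
  ring

/-- The generating polynomial of a single clause, whose `i`-th coefficient is
`k.choose i * p ^ i * q ^ (k - i)` for `0 < i < k` and zero otherwise. -/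
noncomputable def clausePoly (k : ℕ) (p q : ℝ) : ℝ[X] :=
  (C p * X + C q) ^ k - (C p * X) ^ k - C q ^ k

/-- This is the product formula over clauses at a = pX, b = q. Tilting by p and q only rescales each
coefficient, so they can be chosen afterwards to suit j. -/
theorem coeff_clausePoly_pow {m k : ℕ} (hk : 1 ≤ k) (p q : ℝ) (j : ℕ) :
    ((clausePoly k p q) ^ m).coeff j = properCount m k j * (p ^ j * q ^ (m * k - j)) := by
  classical
  rw [clausePoly, ← sum_isProper_prod hk, finsetSum_coeff, properCount, Finset.card_eq_sum_ones,
    Nat.cast_sum, Finset.sum_mul, ← Finset.filter_filter, Finset.sum_filter (p := fun w => ones w = j)]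
  refine Finset.sum_congr rfl fun w _ => ?_
  rw [prod_ite_eq_pow_ones]
  simp only [Fintype.card_prod, Fintype.card_fin]
  rw [mul_pow, mul_right_comm, ← C_pow, ← C_pow, ← C_mul, coeff_C_mul_X_pow]
  by_cases h : ones w = j
  · simp [h]
  · simp [h, Ne.symm h]

theorem coeff_clausePoly {k : ℕ} (p q : ℝ) (i : ℕ) :
    (clausePoly k p q).coeff i
      = p ^ i * q ^ (k - i) * k.choose i - (if i = k then p ^ k else 0)
        - (if i = 0 then q ^ k else 0) := by
  have h : ((C p * X + C q) ^ k).coeff i = p ^ i * q ^ (k - i) * k.choose i := by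
    rw [add_pow, finsetSum_coeff]
    have : ∀ l ∈ range (k + 1), ((C p * X) ^ l * C q ^ (k - l) * (k.choose l : ℝ[X])).coeff i
        = if i = l then p ^ l * q ^ (k - l) * k.choose l else 0 := by
      intro l _
      rw [← coeff_C_mul_X_pow]
      congr 1
      simp only [mul_pow, C_mul, C_pow, map_natCast]
      ring
    rw [Finset.sum_congr rfl this, Finset.sum_ite_eq]
    split_ifs with hi
    · rfl
    · rw [Nat.choose_eq_zero_of_lt (by simpa using hi)]
      simp
  rw [clausePoly, coeff_sub, coeff_sub, h, mul_pow, ← C_pow, ← C_pow, coeff_C_mul_X_pow, coeff_C]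

theorem coeff_clausePoly_of_mem {k i : ℕ} (h0 : 0 < i) (hi : i < k) (p q : ℝ) :
    (clausePoly k p q).coeff i = p ^ i * q ^ (k - i) * k.choose i := by
  rw [coeff_clausePoly, if_neg hi.ne, if_neg h0.ne', sub_zero, sub_zero]

theorem coeff_clausePoly_nonneg {k : ℕ} (hk : 1 ≤ k) {p q : ℝ} (hp : 0 ≤ p) (hq : 0 ≤ q) (i : ℕ) :
    0 ≤ (clausePoly k p q).coeff i := by
  have : 0 ≤ p ^ i * q ^ (k - i) * (k.choose i : ℝ) := by positivity
  rw [coeff_clausePoly]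
  split_ifs with h1 h2 h2
  · omega
  · subst h1
    simp
  · subst h2
    simp
  · simpa using this

theorem eval_one_clausePoly (k : ℕ) (p q : ℝ) :
    (clausePoly k p q).eval 1 = (p + q) ^ k - p ^ k - q ^ k := by
  simp [clausePoly]

/-! ### Anticoncentration for powers of polynomials -/

/-- The middle coefficient suffices. Even rows follow by induction from (2n+1)(2n+3) ≤ 4(n+1)^2; an
odd middle coefficient is half of the next central one. -/
theorem choose_sq_mul_succ_le (r i : ℕ) : r.choose i ^ 2 * (r + 1) ≤ 4 ^ r := by
  have hc : ∀ n : ℕ, n.centralBinom ^ 2 * (2 * n + 1) ≤ 16 ^ n := by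
    intro n
    induction n with
    | zero => simp
    | succ n ih =>
      have h := Nat.succ_mul_centralBinom_succ n
      have h2 : (n + 1) ^ 2 * ((n + 1).centralBinom ^ 2 * (2 * (n + 1) + 1))
          ≤ (n + 1) ^ 2 * 16 ^ (n + 1) := by
        calc (n + 1) ^ 2 * ((n + 1).centralBinom ^ 2 * (2 * (n + 1) + 1))
            = ((n + 1) * (n + 1).centralBinom) ^ 2 * (2 * (n + 1) + 1) := by ring
          _ = 4 * ((2 * n + 1) * (2 * n + 3)) * (n.centralBinom ^ 2 * (2 * n + 1)) := by
              rw [h]; ring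
          _ ≤ 4 * (4 * (n + 1) ^ 2) * 16 ^ n := by
              exact Nat.mul_le_mul (Nat.mul_le_mul_left _ (by nlinarith)) ih
          _ = (n + 1) ^ 2 * 16 ^ (n + 1) := by ring
      exact Nat.le_of_mul_le_mul_left h2 (by positivity)
  have hm := Nat.choose_le_middle i r
  refine (Nat.mul_le_mul_right _ (Nat.pow_le_pow_left hm 2)).trans ?_
  obtain ⟨n, rfl | rfl⟩ := Nat.even_or_odd' r
  · have h := hc n
    rw [Nat.centralBinom_eq_two_mul_choose] at h
    rw [Nat.mul_div_cancel_left n two_pos, pow_mul]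
    exact h
  · have h := hc (n + 1)
    have h2 : (n + 1).centralBinom = 2 * (2 * n + 1).choose n := by
      rw [Nat.centralBinom_eq_two_mul_choose, show 2 * (n + 1) = (2 * n + 1) + 1 by ring,
        Nat.choose_succ_succ' (2 * n + 1) n, Nat.choose_symm_half]
      ring
    rw [h2] at h
    have h3 : (2 * n + 1) / 2 = n := by omega
    rw [h3]
    have h4 : 4 * ((2 * n + 1).choose n ^ 2 * (2 * n + 1 + 1)) ≤ 4 * 4 ^ (2 * n + 1) := by
      calc 4 * ((2 * n + 1).choose n ^ 2 * (2 * n + 1 + 1))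
          ≤ 4 * ((2 * n + 1).choose n ^ 2 * (2 * (n + 1) + 1)) := by gcongr; omega
        _ = (2 * (2 * n + 1).choose n) ^ 2 * (2 * (n + 1) + 1) := by ring
        _ ≤ 16 ^ (n + 1) := h
        _ = 4 * 4 ^ (2 * n + 1) := by
          rw [show (16 : ℕ) = 4 ^ 2 by norm_num, ← pow_mul, ← pow_succ']
          congr 1
    omega

theorem choose_mul_sqrt_succ_le (r i : ℕ) : (r.choose i : ℝ) * √((r : ℝ) + 1) ≤ 2 ^ r := by
  refine abs_le_of_sq_le_sq' ?_ (by positivity) |>.2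
  rw [mul_pow, Real.sq_sqrt (by positivity), ← pow_mul, mul_comm r 2, pow_mul]
  norm_num
  exact_mod_cast choose_sq_mul_succ_le r i

theorem sum_coeff_le_eval_one {g : ℝ[X]} (hg : ∀ i, 0 ≤ g.coeff i) (n : ℕ) :
    ∑ i ∈ range n, g.coeff i ≤ g.eval 1 := by
  rw [eval_eq_sum_range' (n := max n (g.natDegree + 1)) (by simp)]
  simp only [one_pow, mul_one]
  exact Finset.sum_le_sum_of_subset_of_nonneg (by simp) fun i _ _ => hg i

theorem coeff_mul_le {f g : ℝ[X]} {B : ℝ} (hf : ∀ i, f.coeff i ≤ B) (hB : 0 ≤ B)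
    (hg : ∀ i, 0 ≤ g.coeff i) (j : ℕ) : (f * g).coeff j ≤ B * g.eval 1 := by
  rw [mul_comm, coeff_mul, Finset.Nat.sum_antidiagonal_eq_sum_range_succ_mk]
  calc ∑ i ∈ range (j + 1), g.coeff i * f.coeff (j - i)
      ≤ ∑ i ∈ range (j + 1), g.coeff i * B :=
        Finset.sum_le_sum fun i _ => mul_le_mul_of_nonneg_left (hf _) (hg i)
    _ = B * ∑ i ∈ range (j + 1), g.coeff i := by rw [← Finset.sum_mul, mul_comm]
    _ ≤ B * g.eval 1 := mul_le_mul_of_nonneg_left (sum_coeff_le_eval_one hg _) hB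

theorem coeff_mul_nonneg {f g : ℝ[X]} (hf : ∀ i, 0 ≤ f.coeff i) (hg : ∀ i, 0 ≤ g.coeff i)
    (j : ℕ) : 0 ≤ (f * g).coeff j := by
  rw [coeff_mul]
  exact Finset.sum_nonneg fun x _ => mul_nonneg (hf _) (hg _)

theorem coeff_pow_nonneg {f : ℝ[X]} (hf : ∀ i, 0 ≤ f.coeff i) (m j : ℕ) :
    0 ≤ (f ^ m).coeff j := by
  induction m generalizing j with
  | zero =>
    rw [pow_zero, coeff_one]
    split_ifs <;> norm_num
  | succ m ih =>
    rw [pow_succ]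
    exact coeff_mul_nonneg ih hf j

theorem coeff_X_add_X_sq_pow_le (r i : ℕ) :
    (((X : ℝ[X]) + X ^ 2) ^ r).coeff i ≤ 2 ^ r / √((r : ℝ) + 1) := by
  rw [show (X : ℝ[X]) + X ^ 2 = (1 + X) * X by ring, mul_pow, coeff_mul_X_pow']
  split_ifs
  · rw [coeff_one_add_X_pow, le_div_iff₀ (by positivity)]
    exact choose_mul_sqrt_succ_le _ _
  · positivity

/-- Absorption, (m+1) C(m,r) = (r+1) C(m+1,r+1), turns the left side into the expansion of
(a+b)^(m+1) without its zeroth term. -/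
theorem sum_choose_div_succ_le {a b : ℝ} (ha : 0 < a) (hb : 0 ≤ b) (m : ℕ) :
    ∑ r ∈ range (m + 1), a ^ r * b ^ (m - r) * m.choose r / ((r : ℝ) + 1)
      ≤ (a + b) ^ (m + 1) / (((m : ℝ) + 1) * a) := by
  rw [le_div_iff₀ (by positivity), add_pow, Finset.sum_range_succ' _ (m + 1), Finset.sum_mul]
  have h : ∀ r ∈ range (m + 1),
      a ^ r * b ^ (m - r) * m.choose r / ((r : ℝ) + 1) * (((m : ℝ) + 1) * a)
        = a ^ (r + 1) * b ^ (m + 1 - (r + 1)) * ((m + 1).choose (r + 1) : ℕ) := by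
    intro r _
    have hs : ((m : ℝ) + 1) * m.choose r = (m + 1).choose (r + 1) * ((r : ℝ) + 1) := by
      exact_mod_cast Nat.add_one_mul_choose_eq m r
    rw [Nat.add_sub_add_right, div_mul_eq_mul_div, div_eq_iff (by positivity)]
    linear_combination a ^ (r + 1) * b ^ (m - r) * hs
  rw [Finset.sum_congr rfl h]
  have : 0 ≤ a ^ 0 * b ^ (m + 1 - 0) * ((m + 1).choose 0 : ℝ) := by positivity
  linarith

/-- An anticoncentration bound: the coefficients of the `m`-th power of a polynomial with
nonnegative coefficients whose first and second coefficients are bounded below are of order at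
most `1 / √m`, relative to the sum of all of them. -/
theorem coeff_pow_le {g : ℝ[X]} {c : ℝ} (hg : ∀ i, 0 ≤ g.coeff i) (hc : 0 < c)
    (h1 : c ≤ g.coeff 1) (h2 : c ≤ g.coeff 2) (m j : ℕ) :
    (g ^ m).coeff j ≤ g.eval 1 ^ m * √(g.eval 1 / (((m : ℝ) + 1) * (2 * c))) := by
  -- Splitting off c(X + X^2) exhibits `g ^ m` as a binomial mixture: r factors contribute a fair
  -- choice between adjacent exponents, spreading the mass by √r, while the rest cannot increase the
  -- largest coefficient beyond their total mass.
  set h : ℝ[X] := g - C c * (X + X ^ 2) with hh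
  have hcoef : ∀ i, 0 ≤ h.coeff i := by
    intro i
    have hi := hg i
    simp only [hh, coeff_sub, coeff_C_mul, coeff_add, coeff_X, coeff_X_pow]
    by_cases hi1 : i = 1
    · subst hi1; norm_num; exact h1
    · by_cases hi2 : i = 2
      · subst hi2; norm_num; exact h2
      · simp [hi2, Ne.symm hi1, hi]
  have hb : 0 ≤ h.eval 1 := by
    simpa using sum_coeff_le_eval_one hcoef 0
  have hsum : g.eval 1 = 2 * c + h.eval 1 := by
    simp [hh]
    ring
  set b := h.eval 1 with hbdef
  have hexp : (g ^ m).coeff j ≤ ∑ r ∈ range (m + 1),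
      (2 * c) ^ r * b ^ (m - r) * m.choose r * (1 / √((r : ℝ) + 1)) := by
    have hgh : g = C c * (X + X ^ 2) + h := by rw [hh]; ring
    rw [hgh, add_pow, finsetSum_coeff]
    refine Finset.sum_le_sum fun r _ => ?_
    have hk := coeff_mul_le (coeff_X_add_X_sq_pow_le r) (by positivity)
      (coeff_pow_nonneg hcoef (m - r)) j
    have he : (C c * (X + X ^ 2)) ^ r * h ^ (m - r) * (m.choose r : ℝ[X])
        = C (c ^ r * m.choose r) * ((X + X ^ 2) ^ r * h ^ (m - r)) := by
      rw [C_mul, C_pow, map_natCast, mul_pow]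
      ring
    rw [he, coeff_C_mul]
    refine (mul_le_mul_of_nonneg_left hk (by positivity)).trans_eq ?_
    rw [eval_pow, mul_pow]
    ring
  -- Cauchy–Schwarz reduces the binomial average of 1/√(r+1) to that of 1/(r+1), which is explicit.
  have hcs := Finset.sum_mul_sq_le_sq_mul_sq (range (m + 1))
    (fun r => √((2 * c) ^ r * b ^ (m - r) * m.choose r))
    (fun r => √((2 * c) ^ r * b ^ (m - r) * m.choose r) * (1 / √((r : ℝ) + 1)))
  have hw : ∀ r, 0 ≤ (2 * c) ^ r * b ^ (m - r) * (m.choose r : ℝ) := fun r => by positivity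
  have e1 : ∀ r, √((2 * c) ^ r * b ^ (m - r) * (m.choose r : ℝ))
      * (√((2 * c) ^ r * b ^ (m - r) * (m.choose r : ℝ)) * (1 / √((r : ℝ) + 1)))
      = (2 * c) ^ r * b ^ (m - r) * m.choose r * (1 / √((r : ℝ) + 1)) := fun r => by
    rw [← mul_assoc, Real.mul_self_sqrt (hw r)]
  have e2 : ∀ r : ℕ, (√((2 * c) ^ r * b ^ (m - r) * (m.choose r : ℝ)) * (1 / √((r : ℝ) + 1))) ^ 2
      = (2 * c) ^ r * b ^ (m - r) * m.choose r / ((r : ℝ) + 1) := fun r => by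
    rw [mul_pow, Real.sq_sqrt (hw r), div_pow, Real.sq_sqrt (by positivity)]
    ring
  simp only [e1, e2, Real.sq_sqrt (hw _)] at hcs
  rw [← add_pow, ← hsum] at hcs
  have hfin := sum_choose_div_succ_le (by positivity : 0 < 2 * c) hb m
  rw [← hsum] at hfin
  have hG : 0 ≤ g.eval 1 := by rw [hsum]; positivity
  refine hexp.trans (abs_le_of_sq_le_sq' ?_ (by positivity)).2
  refine hcs.trans ((mul_le_mul_of_nonneg_left hfin (by positivity)).trans_eq ?_)
  rw [mul_pow, Real.sq_sqrt (by positivity)]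
  ring

end RegularNAE

/-! ### Stirling estimates for binomial coefficients -/

namespace RegularNAE

open Finset Polynomial

/-- The Stirling sequence decreases from its first value e/√2. Using √(n+1) rather than √n keeps the
bound valid at n = 0. -/
theorem factorial_le_stirling (n : ℕ) :
    (n.factorial : ℝ) ≤ Real.exp 1 * √((n : ℝ) + 1) * (n / Real.exp 1) ^ n := by
  rcases Nat.eq_zero_or_pos n with rfl | hn
  · simp
  · obtain ⟨l, rfl⟩ := Nat.exists_eq_add_of_le' hn
    have h := Stirling.stirlingSeq'_antitone (Nat.zero_le l)
    simp only [Function.comp_apply, Nat.succ_eq_add_one, zero_add, Stirling.stirlingSeq_one] at h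
    rw [Stirling.stirlingSeq, div_le_iff₀ (by positivity)] at h
    refine h.trans ?_
    rw [← mul_assoc]
    refine mul_le_mul_of_nonneg_right ?_ (by positivity)
    rw [Real.sqrt_mul (by norm_num), div_mul_eq_mul_div, div_le_iff₀ (by positivity)]
    have : √(((l + 1 : ℕ) : ℝ)) ≤ √(((l + 1 : ℕ) : ℝ) + 1) := Real.sqrt_le_sqrt (by linarith)
    nlinarith [mul_le_mul_of_nonneg_left this
      (by positivity : 0 ≤ Real.exp 1 * √2)]

/-- The probability that a binomial random variable equals its mean `j` is at least of order
`1 / √n`. -/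
theorem pow_self_le_choose_mul {n j : ℕ} (hj : j ≤ n) :
    (n : ℝ) ^ n ≤ Real.exp 1 ^ 2 * √((n : ℝ) + 1) * n.choose j
      * ((j : ℝ) ^ j * ((n - j : ℕ) : ℝ) ^ (n - j)) := by
  rcases Nat.eq_zero_or_pos n with rfl | hn
  · obtain rfl : j = 0 := by omega
    simp only [Nat.cast_zero, pow_zero, zero_add, Real.sqrt_one, mul_one, Nat.choose_self,
      Nat.cast_one, Nat.sub_zero]
    exact one_le_pow₀ (Real.one_le_exp zero_le_one)
  set e := Real.exp 1 with he
  have he0 : 0 < e := Real.exp_pos 1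
  have h1 := Stirling.le_factorial_stirling n
  have h2 := factorial_le_stirling j
  have h3 := factorial_le_stirling (n - j)
  rw [← he] at h1 h2 h3
  have hfac : (n.factorial : ℝ) = n.choose j * (j.factorial * (n - j).factorial) := by
    rw [← mul_assoc]
    exact_mod_cast (Nat.choose_mul_factorial_mul_factorial hj).symm
  have hn' : (1 : ℝ) ≤ n := by exact_mod_cast hn
  have hjn : ((n - j : ℕ) : ℝ) = n - j := Nat.cast_sub hj
  have hjn' : (j : ℝ) ≤ n := by exact_mod_cast hj
  have hj0 : (0 : ℝ) ≤ j := by positivity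
  have hs : √((j : ℝ) + 1) * √(((n - j : ℕ) : ℝ) + 1) ≤ √(2 * Real.pi * n) * √((n : ℝ) + 1) := by
    rw [← Real.sqrt_mul (by positivity), ← Real.sqrt_mul (by positivity)]
    refine Real.sqrt_le_sqrt ?_
    have hpi := Real.pi_gt_three
    calc ((j : ℝ) + 1) * (((n - j : ℕ) : ℝ) + 1) ≤ ((n : ℝ) + 1) * ((n : ℝ) + 1) := by
          rw [hjn]; gcongr; linarith
      _ ≤ 2 * Real.pi * n * ((n : ℝ) + 1) := by gcongr; nlinarith
  have hpow : (e : ℝ) ^ n = e ^ j * e ^ (n - j) := by rw [← pow_add, Nat.add_sub_cancel' hj]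
  have hmain : √(2 * Real.pi * n) * (n / e) ^ n
      ≤ √(2 * Real.pi * n) * (e ^ 2 * √((n : ℝ) + 1) * n.choose j
        * (((j : ℝ) / e) ^ j * (((n - j : ℕ) : ℝ) / e) ^ (n - j))) := by
    calc √(2 * Real.pi * n) * (n / e) ^ n ≤ n.choose j * (j.factorial * (n - j).factorial) := by
          rw [← hfac]; exact h1
      _ ≤ n.choose j * ((e * √((j : ℝ) + 1) * (j / e) ^ j)
          * (e * √(((n - j : ℕ) : ℝ) + 1) * (((n - j : ℕ) : ℝ) / e) ^ (n - j))) := by gcongr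
      _ = (√((j : ℝ) + 1) * √(((n - j : ℕ) : ℝ) + 1)) * (e ^ 2 * n.choose j
          * ((j / e) ^ j * (((n - j : ℕ) : ℝ) / e) ^ (n - j))) := by ring
      _ ≤ (√(2 * Real.pi * n) * √((n : ℝ) + 1)) * (e ^ 2 * n.choose j
          * ((j / e) ^ j * (((n - j : ℕ) : ℝ) / e) ^ (n - j))) := by gcongr
      _ = _ := by ring
  have hc := le_of_mul_le_mul_left hmain (by positivity)
  rw [div_pow, div_pow, div_pow, div_mul_div_comm, ← hpow, ← mul_div_assoc] at hc
  exact (div_le_div_iff_of_pos_right (by positivity)).1 hc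

/-- A Gaussian lower bound for the binomial distribution with parameter `1 / 2`. -/
theorem two_pow_mul_exp_le_choose {n s : ℕ} (hn : 0 < n) (hs : s ≤ n) :
    (2 : ℝ) ^ n * Real.exp (-(4 * ((s : ℝ) - n / 2) ^ 2 / n))
      ≤ Real.exp 1 ^ 2 * √((n : ℝ) + 1) * n.choose s := by
  have hn' : (0 : ℝ) < n := by exact_mod_cast hn
  have hsn : ((n - s : ℕ) : ℝ) = n - s := Nat.cast_sub hs
  have h := pow_self_le_choose_mul hs
  -- From 1 + u ≤ e^u with u = 2t/n - 1. The exponents for t = s and t = n - s add up to exactly 4(s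
  -- - n/2)^2/n.
  have hexp : ∀ t : ℕ, (2 * (t : ℝ) / n) ^ t ≤ Real.exp (t * (2 * t / n - 1)) := fun t => by
    rw [Real.exp_nat_mul]
    refine pow_le_pow_left₀ (by positivity) ?_ t
    have := Real.add_one_le_exp (2 * (t : ℝ) / n - 1)
    linarith
  have hb : (2 * (s : ℝ) / n) ^ s * (2 * ((n - s : ℕ) : ℝ) / n) ^ (n - s)
      ≤ Real.exp (4 * ((s : ℝ) - n / 2) ^ 2 / n) := by
    refine (mul_le_mul (hexp s) (hexp (n - s)) (by positivity) (by positivity)).trans_eq ?_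
    rw [← Real.exp_add, hsn]
    congr 1
    field_simp
    ring
  have hb' : 2 ^ n * ((s : ℝ) ^ s * ((n - s : ℕ) : ℝ) ^ (n - s))
      ≤ Real.exp (4 * ((s : ℝ) - n / 2) ^ 2 / n) * n ^ n := by
    rw [← div_le_iff₀ (by positivity)]
    refine le_of_eq_of_le ?_ hb
    have h2 : (2 : ℝ) ^ n = 2 ^ s * 2 ^ (n - s) := by rw [← pow_add, Nat.add_sub_cancel' hs]
    have h3 : (n : ℝ) ^ n = n ^ s * n ^ (n - s) := by rw [← pow_add, Nat.add_sub_cancel' hs]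
    rw [h2, h3, div_pow, div_pow, mul_pow, mul_pow, div_mul_div_comm]
    congr 1
    ring
  rw [Real.exp_neg, ← div_eq_mul_inv, div_le_iff₀ (Real.exp_pos _)]
  have hnn : (0 : ℝ) < (n : ℝ) ^ n := by positivity
  refine le_of_mul_le_mul_right ?_ hnn
  calc (2 : ℝ) ^ n * n ^ n ≤ 2 ^ n * (Real.exp 1 ^ 2 * √((n : ℝ) + 1) * n.choose s
      * ((s : ℝ) ^ s * ((n - s : ℕ) : ℝ) ^ (n - s))) := by gcongr
    _ = Real.exp 1 ^ 2 * √((n : ℝ) + 1) * n.choose s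
      * (2 ^ n * ((s : ℝ) ^ s * ((n - s : ℕ) : ℝ) ^ (n - s))) := by ring
    _ ≤ Real.exp 1 ^ 2 * √((n : ℝ) + 1) * n.choose s
      * (Real.exp (4 * ((s : ℝ) - n / 2) ^ 2 / n) * n ^ n) := by gcongr
    _ = _ := by ring

/-! ### Uniform upper bound for proper colourings -/

theorem IsProper.le_ones {m k : ℕ} {w : Fin m × Fin k → Bool} (hw : IsProper w) :
    m ≤ ones w := by
  have hf : ∀ a, ∃ i, w (a, i) = true := by
    intro a
    by_contra! h
    refine hw a fun i j => ?_
    simp only [ne_eq, Bool.not_eq_true] at h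
    exact (h i).trans (h j).symm
  choose f hf using hf
  have : (univ.image fun a : Fin m => (a, f a)) ⊆ univ.filter fun e => w e = true := by
    intro e he
    simp only [mem_image, mem_univ, true_and] at he
    obtain ⟨a, rfl⟩ := he
    simpa using hf a
  have h := Finset.card_le_card this
  rw [Finset.card_image_of_injective _ fun a b hab => (Prod.ext_iff.1 hab).1, Finset.card_univ,
    Fintype.card_fin] at h
  exact h

theorem IsProper.ones_add_le {m k : ℕ} {w : Fin m × Fin k → Bool} (hw : IsProper w) :
    ones w + m ≤ m * k := by
  have hw' : IsProper fun e => !w e := by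
    intro a h
    exact hw a fun i j => by simpa using h i j
  have h1 := hw'.le_ones
  have h2 : ones (fun e => !w e) = m * k - ones w := by
    have := card_fiber_false w
    rw [Fintype.card_prod, Fintype.card_fin, Fintype.card_fin] at this
    rw [← this, ← card_fiber_true]
    exact Fintype.card_congr (Equiv.subtypeEquivRight fun e => by simp)
  have h3 : ones w ≤ m * k := by simpa using ones_le_card w
  omega

/-- A proper clause has a half-edge of each colour. This keeps both tilted densities at least 1/k
wherever the count is nonzero. -/
theorem le_and_add_le_of_properCount_ne_zero {m k j : ℕ} (h : properCount m k j ≠ 0) :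
    m ≤ j ∧ j + m ≤ m * k := by
  classical
  obtain ⟨w, hw⟩ := Finset.card_ne_zero.1 h
  simp only [mem_filter, mem_univ, true_and] at hw
  obtain ⟨hw, rfl⟩ := hw
  exact ⟨hw.le_ones, hw.ones_add_le⟩

theorem properCount_zero_le (k j : ℕ) : properCount 0 k j ≤ 1 := by
  classical
  refine (Finset.card_le_univ _).trans ?_
  simp

/-- A uniformly random set of `j` half-edges properly colours all clauses with probability at most
a constant times the corresponding probability for independent uniform colours. -/
theorem exists_properCount_le {k : ℕ} (hk : 3 ≤ k) :
    ∃ K : ℝ, 0 < K ∧ ∀ m j : ℕ, j ≤ m * k →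
      (properCount m k j : ℝ) * 2 ^ (m * k) ≤ K * (2 ^ k - 2) ^ m * (m * k).choose j := by
  set c : ℝ := (1 / k) ^ k with hc
  have hk0 : (0 : ℝ) < k := by exact_mod_cast (by omega : 0 < k)
  have hc0 : 0 < c := by positivity
  -- The summand 1 covers m = 0; the other is the constant left when √(N+1) meets 1/√(m+1).
  refine ⟨1 + Real.exp 1 ^ 2 * √(k / (2 * c)), by positivity, fun m j hj => ?_⟩
  rcases Nat.eq_zero_or_pos m with rfl | hm
  · obtain rfl : j = 0 := by omega
    have h1 : (properCount 0 k 0 : ℝ) ≤ 1 := by exact_mod_cast properCount_zero_le k 0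
    simp only [zero_mul, pow_zero, mul_one, Nat.choose_self, Nat.cast_one]
    have : 0 ≤ Real.exp 1 ^ 2 * √(k / (2 * c)) := by positivity
    linarith
  have h2k : (2 : ℝ) ≤ 2 ^ k := le_self_pow₀ one_le_two (by omega)
  by_cases hA : properCount m k j = 0
  · rw [hA]
    have : (0 : ℝ) ≤ 2 ^ k - 2 := by linarith
    simp only [Nat.cast_zero, zero_mul]
    positivity
  obtain ⟨hj1, hj2⟩ := le_and_add_le_of_properCount_ne_zero hA
  have hm' : (0 : ℝ) < m := by exact_mod_cast hm
  set N := m * k with hN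
  have hNr : (N : ℝ) = m * k := by rw [hN]; push_cast; ring
  have hN0 : (0 : ℝ) < N := by rw [hNr]; positivity
  set p : ℝ := j / N with hp
  set q : ℝ := ((N - j : ℕ) : ℝ) / N with hq
  have hpq : p + q = 1 := by
    rw [hp, hq, ← add_div, Nat.cast_sub hj]
    field_simp
    ring
  have hmN : (m : ℝ) / N = 1 / k := by
    rw [hNr]
    field_simp
  have hp1 : 1 / (k : ℝ) ≤ p := by
    rw [← hmN, hp]
    gcongr
  have hq1 : 1 / (k : ℝ) ≤ q := by
    rw [← hmN, hq]
    gcongr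
    omega
  have hk1 : (0 : ℝ) < 1 / k := by positivity
  have hp0 : 0 < p := hk1.trans_le hp1
  have hq0 : 0 < q := hk1.trans_le hq1
  have hcoef : ∀ i, 0 < i → i < k → c ≤ (clausePoly k p q).coeff i := by
    intro i hi hik
    rw [coeff_clausePoly_of_mem hi hik]
    have h1 : (1 : ℝ) ≤ k.choose i := by exact_mod_cast Nat.choose_pos hik.le
    calc c = (1 / (k : ℝ)) ^ i * (1 / k) ^ (k - i) * 1 := by
          rw [hc, mul_one, ← pow_add, Nat.add_sub_cancel' hik.le]
      _ ≤ p ^ i * q ^ (k - i) * k.choose i := by gcongr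
  -- Here k ≥ 3 is essential: both 1 and 2 must be admissible numbers of ones in a clause.
  have hU := coeff_pow_le (coeff_clausePoly_nonneg (by omega) hp0.le hq0.le) hc0
    (hcoef 1 one_pos (by omega)) (hcoef 2 two_pos (by omega)) m j
  rw [coeff_clausePoly_pow (by omega), eval_one_clausePoly, hpq, one_pow, ← hN] at hU
  have hpow := add_pow_le hp0.le hq0.le k
  rw [hpq, one_pow] at hpow
  have h2k' : (2 : ℝ) ^ k = 2 * 2 ^ (k - 1) := by
    rw [← pow_succ', Nat.sub_add_cancel (by omega)]
  have hg0 : 0 ≤ 1 - p ^ k - q ^ k := by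
    rw [show 1 - p ^ k - q ^ k = (clausePoly k p q).eval 1 by
      rw [eval_one_clausePoly, hpq, one_pow]]
    simpa using sum_coeff_le_eval_one (coeff_clausePoly_nonneg (by omega) hp0.le hq0.le) 0
  have hg1 : 1 - p ^ k - q ^ k ≤ 1 := by
    have : 0 < p ^ k := by positivity
    have : 0 < q ^ k := by positivity
    linarith
  -- Convexity of the k-th power: p^k + q^k is smallest at p = q = 1/2.
  have hgW : (1 - p ^ k - q ^ k) * 2 ^ k ≤ 2 ^ k - 2 := by
    nlinarith
  have hS := pow_self_le_choose_mul hj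
  have hS' : 1 ≤ Real.exp 1 ^ 2 * √((N : ℝ) + 1) * N.choose j * (p ^ j * q ^ (N - j)) := by
    have hNN : (N : ℝ) ^ N = N ^ j * N ^ (N - j) := by
      rw [← pow_add, Nat.add_sub_cancel' hj]
    rw [hp, hq, div_pow, div_pow, div_mul_div_comm, ← hNN, ← mul_div_assoc,
      le_div_iff₀ (by positivity), one_mul]
    exact hS
  have hsq : √((N : ℝ) + 1) * √((1 - p ^ k - q ^ k) / (((m : ℝ) + 1) * (2 * c)))
      ≤ √(k / (2 * c)) := by
    rw [← Real.sqrt_mul (by positivity)]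
    refine Real.sqrt_le_sqrt ?_
    have h1k : (1 : ℝ) ≤ k := by exact_mod_cast (by omega : 1 ≤ k)
    rw [mul_div_assoc', div_le_div_iff₀ (by positivity) (by positivity), hNr]
    calc ((m : ℝ) * k + 1) * (1 - p ^ k - q ^ k) * (2 * c) ≤ ((m : ℝ) * k + k) * 1 * (2 * c) := by
          gcongr
      _ = k * (((m : ℝ) + 1) * (2 * c)) := by ring
  have hW : ((1 - p ^ k - q ^ k) * 2 ^ k) ^ m ≤ (2 ^ k - 2) ^ m :=
    pow_le_pow_left₀ (by positivity) hgW m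
  have hW0 : (0 : ℝ) ≤ (2 ^ k - 2) ^ m := pow_nonneg (by linarith) m
  calc (properCount m k j : ℝ) * 2 ^ N
      ≤ (properCount m k j : ℝ) * 2 ^ N
        * (Real.exp 1 ^ 2 * √((N : ℝ) + 1) * N.choose j * (p ^ j * q ^ (N - j))) :=
        le_mul_of_one_le_right (by positivity) hS'
    _ = (Real.exp 1 ^ 2 * √((N : ℝ) + 1) * N.choose j * 2 ^ N)
        * (properCount m k j * (p ^ j * q ^ (N - j))) := by ring
    _ ≤ (Real.exp 1 ^ 2 * √((N : ℝ) + 1) * N.choose j * 2 ^ N)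
        * ((1 - p ^ k - q ^ k) ^ m * √((1 - p ^ k - q ^ k) / (((m : ℝ) + 1) * (2 * c)))) := by
        gcongr
    _ = Real.exp 1 ^ 2 * (√((N : ℝ) + 1) * √((1 - p ^ k - q ^ k) / (((m : ℝ) + 1) * (2 * c))))
        * ((1 - p ^ k - q ^ k) * 2 ^ k) ^ m * N.choose j := by
        rw [mul_pow, ← pow_mul, mul_comm k m, ← hN]
        ring
    _ ≤ Real.exp 1 ^ 2 * √(k / (2 * c)) * (2 ^ k - 2) ^ m * N.choose j := by
        gcongr
    _ ≤ (1 + Real.exp 1 ^ 2 * √(k / (2 * c))) * (2 ^ k - 2) ^ m * N.choose j := by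
        gcongr
        linarith

end RegularNAE

/-! ### Mass on multiples of d, and the second moment -/

namespace RegularNAE

open Finset Polynomial

theorem coeff_clausePoly_one_pow {m k : ℕ} (hk : 1 ≤ k) (j : ℕ) :
    ((clausePoly k 1 1) ^ m).coeff j = properCount m k j := by
  rw [coeff_clausePoly_pow hk]
  simp

theorem eval_one_clausePoly_one (k : ℕ) : (clausePoly k 1 1).eval 1 = 2 ^ k - 2 := by
  rw [eval_one_clausePoly]
  norm_num
  ring

theorem natDegree_clausePoly_le (k : ℕ) (p q : ℝ) : (clausePoly k p q).natDegree ≤ k := by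
  rw [natDegree_le_iff_coeff_eq_zero]
  intro i hi
  rw [coeff_clausePoly, if_neg (by omega), if_neg (by omega), Nat.choose_eq_zero_of_lt hi]
  simp

theorem sum_properCount {m k : ℕ} (hk : 1 ≤ k) :
    ∑ j ∈ range (m * k + 1), (properCount m k j : ℝ) = (2 ^ k - 2) ^ m := by
  rw [← eval_one_clausePoly_one, ← eval_pow, eval_eq_sum_range' (n := m * k + 1)]
  · simp [coeff_clausePoly_one_pow hk]
  · exact Nat.lt_succ_of_le (natDegree_pow_le_of_le m (natDegree_clausePoly_le k 1 1))

theorem properCount_add {m l k : ℕ} (hk : 1 ≤ k) (j : ℕ) :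
    properCount (m + l) k j
      = ∑ a ∈ range (j + 1), properCount m k a * properCount l k (j - a) := by
  have h := coeff_clausePoly_one_pow (m := m + l) hk j
  rw [pow_add, coeff_mul, Finset.Nat.sum_antidiagonal_eq_sum_range_succ_mk] at h
  simp only [coeff_clausePoly_one_pow hk] at h
  exact_mod_cast h.symm

theorem properCount_pos {k : ℕ} (hk : 3 ≤ k) {m j : ℕ} (h1 : m ≤ j) (h2 : j + m ≤ m * k) :
    0 < properCount m k j := by
  induction m generalizing j with
  | zero =>
    obtain rfl : j = 0 := by omega
    have h := coeff_clausePoly_one_pow (m := 0) (by omega : 1 ≤ k) 0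
    rw [pow_zero, coeff_one_zero] at h
    exact_mod_cast h ▸ one_pos
  | succ m ih =>
    obtain ⟨l, rfl⟩ : ∃ l, k = l + 1 := ⟨k - 1, by omega⟩
    have hml : m ≤ m * l := Nat.le_mul_of_pos_right m (by omega)
    rw [Nat.mul_succ, Nat.succ_mul] at h2
    -- The last clause takes as few ones as possible, subject to being proper and leaving at most ml
    -- for the other m clauses.
    set i := max 1 (j - m * l) with hi
    have hi1 : 1 ≤ i := le_max_left _ _
    rw [properCount_add (by omega)]
    refine Finset.sum_pos' (fun _ _ => Nat.zero_le _) ⟨j - i, by simp, ?_⟩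
    have hij : j - (j - i) = i := by omega
    rw [hij]
    refine Nat.mul_pos (ih (by omega) (by rw [Nat.mul_succ]; omega)) ?_
    have h := coeff_clausePoly_one_pow (m := 1) (by omega : 1 ≤ l + 1) i
    rw [pow_one, coeff_clausePoly_of_mem (by omega) (by omega), one_pow, one_pow, one_mul,
      one_mul] at h
    have : (l + 1).choose i = properCount 1 (l + 1) i := by exact_mod_cast h
    rw [← this]
    exact Nat.choose_pos (by omega)

/-- The number of `true` entries of a random proper colouring is divisible by `d` with
probability bounded below. -/
theorem pow_le_sum_properCount_dvd {k d n m : ℕ} (hk : 3 ≤ k) (hd : 0 < d) (hn : 2 ≤ n)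
    (h : n * d = m * k) :
    ((2 : ℝ) ^ k - 2) ^ m
      ≤ (2 ^ k - 2) ^ d * ∑ j ∈ range (m * k + 1) with d ∣ j, (properCount m k j : ℝ) := by
  have hW : (1 : ℝ) ≤ 2 ^ k - 2 := by
    have : (2 : ℝ) ^ 3 ≤ 2 ^ k := pow_le_pow_right₀ one_le_two hk
    linarith
  rcases lt_or_ge m d with hmd | hmd
  · have hpos : 0 < properCount m k (n / 2 * d) := by
      have h3 : n ≤ 3 * (n / 2) := by omega
      have h4 : m * k ≤ 3 * (n / 2 * d) := by
        rw [← h, ← mul_assoc]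
        exact Nat.mul_le_mul_right d h3
      have h5 : m * 3 ≤ m * k := Nat.mul_le_mul_left m hk
      have h6 : 2 * (n / 2 * d) ≤ n * d := by
        rw [← mul_assoc]
        exact Nat.mul_le_mul_right d (by omega)
      apply properCount_pos hk
      · have : m * k ≤ k * (n / 2 * d) := h4.trans (Nat.mul_le_mul_right _ hk)
        exact Nat.le_of_mul_le_mul_left (by rwa [mul_comm k m]) (by omega : 0 < k)
      · have : m ≤ n / 2 * d := by
          have : m * k ≤ k * (n / 2 * d) := h4.trans (Nat.mul_le_mul_right _ hk)
          exact Nat.le_of_mul_le_mul_left (by rwa [mul_comm k m]) (by omega : 0 < k)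
        omega
    have hsum : (1 : ℝ) ≤ ∑ j ∈ range (m * k + 1) with d ∣ j, (properCount m k j : ℝ) := by
      have h1 : (1 : ℝ) ≤ properCount m k (n / 2 * d) := by exact_mod_cast hpos
      refine h1.trans (Finset.single_le_sum (f := fun j => (properCount m k j : ℝ))
        (fun _ _ => by positivity) ?_)
      simp only [mem_filter, mem_range, dvd_mul_left, and_true, ← h]
      exact Nat.lt_succ_of_le (Nat.mul_le_mul_right d (Nat.div_le_self n 2))
    calc ((2 : ℝ) ^ k - 2) ^ m ≤ (2 ^ k - 2) ^ d * 1 := by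
          rw [mul_one]; exact pow_le_pow_right₀ hW hmd.le
      _ ≤ _ := by gcongr
  · obtain ⟨l, rfl⟩ := Nat.exists_eq_add_of_le' hmd
    rw [pow_add, mul_comm]
    refine mul_le_mul_of_nonneg_left ?_ (by positivity)
    rw [← sum_properCount (m := l) (by omega : 1 ≤ k)]
    -- The d reserved clauses supply t(a) ones, completing a to a multiple of d. Since d < t(a) ≤ 2d
    -- ≤ d(k - 1), they can do so properly.
    set t : ℕ → ℕ := fun a => d + (d - a % d) with ht
    have hmod : ∀ a, a % d < d := fun a => Nat.mod_lt a hd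
    have hdvd : ∀ a, d ∣ a + t a := by
      intro a
      have h1 := Nat.mod_add_div a d
      have h2 := hmod a
      refine ⟨a / d + 2, ?_⟩
      rw [mul_add]
      simp only [ht]
      omega
    have hd3 : d * 3 ≤ d * k := Nat.mul_le_mul_left d hk
    have hterm : ∀ j, ∑ a ∈ range (l * k + 1), (if j = a + t a then properCount l k a else 0)
        ≤ properCount (l + d) k j := by
      intro j
      rw [properCount_add (by omega)]
      calc ∑ a ∈ range (l * k + 1), (if j = a + t a then properCount l k a else 0)
          = ∑ a ∈ range (l * k + 1) with j = a + t a, properCount l k a := by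
            rw [Finset.sum_filter]
        _ ≤ ∑ a ∈ range (l * k + 1) with j = a + t a,
              properCount l k a * properCount d k (j - a) := by
            refine Finset.sum_le_sum fun a ha => ?_
            obtain rfl := (mem_filter.1 ha).2
            refine Nat.le_mul_of_pos_right _ (properCount_pos hk ?_ ?_)
            · simp only [ht]; omega
            · have := hmod a
              simp only [ht]; omega
        _ ≤ _ := by
            refine Finset.sum_le_sum_of_subset fun a ha => ?_
            have := (mem_filter.1 ha).2
            rw [mem_range]
            omega
    have hnat : ∑ a ∈ range (l * k + 1), properCount l k a
        ≤ ∑ j ∈ range ((l + d) * k + 1) with d ∣ j, properCount (l + d) k j := by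
      refine le_trans (le_of_eq ?_) (Finset.sum_le_sum fun j _ => hterm j)
      rw [Finset.sum_comm]
      refine Finset.sum_congr rfl fun a ha => ?_
      rw [Finset.sum_ite_eq', if_pos]
      simp only [mem_filter, mem_range, hdvd, and_true] at ha ⊢
      have := hmod a
      rw [add_mul]
      simp only [ht]
      omega
    exact_mod_cast hnat

theorem sum_choose_mul_sub_half_sq (N : ℕ) :
    ∑ j ∈ range (N + 1), (N.choose j : ℝ) * ((j : ℝ) - N / 2) ^ 2 = 2 ^ N * ((N : ℝ) / 4) := by
  have h := congrArg (Polynomial.eval (1 / 2 : ℝ)) (bernsteinPolynomial.variance ℝ N)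
  simp only [eval_finsetSum, eval_mul, eval_pow, eval_sub, eval_natCast, eval_X, eval_one,
    nsmul_eq_mul, bernsteinPolynomial] at h
  have h2 : ∀ j ∈ range (N + 1), (N.choose j : ℝ) * ((j : ℝ) - N / 2) ^ 2
      = 2 ^ N * (((N : ℝ) * (1 / 2) - j) ^ 2
        * (N.choose j * (1 / 2) ^ j * (1 - 1 / 2) ^ (N - j))) := by
    intro j hj
    have hjN : j ≤ N := Nat.lt_succ_iff.1 (mem_range.1 hj)
    have e1 : (1 / 2 : ℝ) ^ j * (1 / 2) ^ (N - j) = (1 / 2) ^ N := by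
      rw [← pow_add, Nat.add_sub_cancel' hjN]
    have e2 : (2 : ℝ) ^ N * (1 / 2) ^ N = 1 := by rw [← mul_pow]; norm_num
    rw [show (1 - 1 / 2 : ℝ) = 1 / 2 by norm_num, mul_assoc (N.choose j : ℝ), e1]
    linear_combination -(N.choose j : ℝ) * ((j : ℝ) - N / 2) ^ 2 * e2
  rw [Finset.sum_congr rfl h2, ← Finset.mul_sum, h]
  ring

/-- Pointwise domination by the binomial weights transfers the binomial variance N/4. -/
theorem sum_properCount_mul_sub_half_sq_le {k m : ℕ} {K : ℝ}
    (hK : ∀ j : ℕ, j ≤ m * k →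
      (properCount m k j : ℝ) * 2 ^ (m * k) ≤ K * (2 ^ k - 2) ^ m * (m * k).choose j) :
    ∑ j ∈ range (m * k + 1), (properCount m k j : ℝ) * ((j : ℝ) - (m * k : ℕ) / 2) ^ 2
      ≤ K * (2 ^ k - 2) ^ m * (((m * k : ℕ) : ℝ) / 4) := by
  refine le_of_mul_le_mul_right ?_ (by positivity : (0 : ℝ) < 2 ^ (m * k))
  calc (∑ j ∈ range (m * k + 1), (properCount m k j : ℝ) * ((j : ℝ) - (m * k : ℕ) / 2) ^ 2)
        * 2 ^ (m * k)
      = ∑ j ∈ range (m * k + 1),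
        ((properCount m k j : ℝ) * 2 ^ (m * k)) * ((j : ℝ) - (m * k : ℕ) / 2) ^ 2 := by
        rw [Finset.sum_mul]
        exact Finset.sum_congr rfl fun j _ => by ring
    _ ≤ ∑ j ∈ range (m * k + 1),
        (K * (2 ^ k - 2) ^ m * (m * k).choose j) * ((j : ℝ) - (m * k : ℕ) / 2) ^ 2 := by
        refine Finset.sum_le_sum fun j hj => ?_
        exact mul_le_mul_of_nonneg_right (hK j (Nat.lt_succ_iff.1 (mem_range.1 hj))) (sq_nonneg _)
    _ = K * (2 ^ k - 2) ^ m
        * ∑ j ∈ range (m * k + 1),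
          ((m * k).choose j : ℝ) * ((j : ℝ) - (m * k : ℕ) / 2) ^ 2 := by
        rw [Finset.mul_sum]
        exact Finset.sum_congr rfl fun j _ => by ring
    _ = _ := by
        rw [sum_choose_mul_sub_half_sq]
        ring

theorem sum_range_mul_eq {R : Type*} [AddCommMonoid R] {d : ℕ} (hd : 0 < d) (n : ℕ) (F : ℕ → R) :
    ∑ s ∈ range (n + 1), F (s * d) = ∑ j ∈ range (n * d + 1) with d ∣ j, F j := by
  refine Finset.sum_nbij' (fun s => s * d) (fun j => j / d) ?_ ?_ ?_ ?_ ?_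
  · intro s hs
    simp only [mem_filter, mem_range, dvd_mul_left, and_true] at hs ⊢
    exact Nat.lt_succ_of_le (Nat.mul_le_mul_right d (Nat.lt_succ_iff.1 hs))
  · intro j hj
    simp only [mem_filter, mem_range] at hj ⊢
    exact Nat.lt_succ_of_le (Nat.div_le_of_le_mul (by rw [mul_comm]; omega))
  · intro s _
    exact Nat.mul_div_cancel s hd
  · intro j hj
    exact Nat.div_mul_cancel (mem_filter.1 hj).2
  · intro s _
    rfl

/-- Linearizing the Gaussian factor lets a second moment control it; the free cutoff `K` makes the
subtracted term as small as needed. -/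
theorem exp_neg_mul_one_sub_div_le {K x : ℝ} (hK : 0 < K) (hx : 0 ≤ x) :
    Real.exp (-K) * (1 - x / K) ≤ Real.exp (-x) := by
  rcases le_total x K with h | h
  · have h1 : 1 - x / K ≤ 1 := by
      have : 0 ≤ x / K := by positivity
      linarith
    calc Real.exp (-K) * (1 - x / K) ≤ Real.exp (-K) * 1 := by gcongr
      _ ≤ Real.exp (-x) := by
        rw [mul_one]
        exact Real.exp_le_exp.2 (by linarith)
  · have h1 : 1 - x / K ≤ 0 := by
      have : 1 ≤ x / K := (one_le_div hK).2 h
      linarith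
    exact (mul_nonpos_of_nonneg_of_nonpos (Real.exp_pos _).le h1).trans (Real.exp_pos _).le

/-! ### The two bounds on the expected number of colourings -/

theorem expectedColorings_le {k d n m : ℕ} {K : ℝ} (h : n * d = m * k)
    (hK : ∀ j : ℕ, j ≤ m * k →
      (properCount m k j : ℝ) * 2 ^ (m * k) ≤ K * (2 ^ k - 2) ^ m * (m * k).choose j) :
    expectedColorings n m d k ≤ K * (2 ^ n * ((2 ^ k - 2) ^ m / 2 ^ (m * k))) := by
  rw [expectedColorings_eq h]
  calc ∑ s ∈ range (n + 1), (n.choose s : ℝ) * (properCount m k (s * d) / (n * d).choose (s * d))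
      ≤ ∑ s ∈ range (n + 1), (n.choose s : ℝ) * (K * (2 ^ k - 2) ^ m / 2 ^ (m * k)) := by
        refine Finset.sum_le_sum fun s hs => ?_
        have hs' : s * d ≤ n * d := Nat.mul_le_mul_right _ (Nat.lt_succ_iff.1 (mem_range.1 hs))
        have hpos : (0 : ℝ) < (n * d).choose (s * d) := by exact_mod_cast Nat.choose_pos hs'
        refine mul_le_mul_of_nonneg_left ?_ (by positivity)
        rw [div_le_div_iff₀ hpos (by positivity), h]
        exact hK _ (h ▸ hs')
    _ = _ := by
        rw [← Finset.sum_mul]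
        have : ∑ s ∈ range (n + 1), (n.choose s : ℝ) = 2 ^ n := by
          exact_mod_cast Nat.sum_range_choose n
        rw [this]
        ring

theorem le_expectedColorings {k d n m : ℕ} {K : ℝ} (hk : 3 ≤ k) (hd : 0 < d) (hn : 2 ≤ n)
    (h : n * d = m * k) (hK0 : 0 < K)
    (hK : ∀ j : ℕ, j ≤ m * k →
      (properCount m k j : ℝ) * 2 ^ (m * k) ≤ K * (2 ^ k - 2) ^ m * (m * k).choose j) :
    Real.exp (-(2 * K * d * (2 ^ k - 2) ^ d)) / (2 * Real.exp 1 ^ 2 * (2 ^ k - 2) ^ d)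
        * (2 ^ n * ((2 ^ k - 2) ^ m / 2 ^ (m * k)))
      ≤ expectedColorings n m d k := by
  have hW : (0 : ℝ) < 2 ^ k - 2 := by
    have : (2 : ℝ) ^ 3 ≤ 2 ^ k := pow_le_pow_right₀ one_le_two hk
    linarith
  set W : ℝ := 2 ^ k - 2 with hWdef
  -- Chosen so that (4/(nD)) · K W^m · N/4 is half of W^m/W^d, the guaranteed mass on multiples of
  -- d.
  set D : ℝ := 2 * K * d * W ^ d with hD
  have hd' : (1 : ℝ) ≤ d := by exact_mod_cast hd
  have hn' : (0 : ℝ) < n := by exact_mod_cast (by omega : 0 < n)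
  have hD0 : 0 < D := by positivity
  set N := m * k with hN
  have hNr : (N : ℝ) = n * d := by exact_mod_cast h.symm
  set A : ℕ → ℝ := fun j => properCount m k j with hA
  have hA0 : ∀ j, 0 ≤ A j := fun j => by positivity
  have hterm : ∀ s ∈ range (n + 1),
      2 ^ n / 2 ^ N * (Real.exp (-D) / Real.exp 1 ^ 2)
        * (A (s * d) * (1 - 4 / (n * D) * (((s * d : ℕ) : ℝ) - N / 2) ^ 2))
      ≤ (n.choose s : ℝ) * (A (s * d) / (n * d).choose (s * d)) := by
    intro s hs
    have hsn : s ≤ n := Nat.lt_succ_iff.1 (mem_range.1 hs)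
    have hs' : s * d ≤ N := h ▸ Nat.mul_le_mul_right _ hsn
    have hpos : (0 : ℝ) < N.choose (s * d) := by exact_mod_cast Nat.choose_pos hs'
    have h1 := two_pow_mul_exp_le_choose (by omega : 0 < n) hsn
    have h2 := choose_mul_sqrt_succ_le N (s * d)
    have h3 := exp_neg_mul_one_sub_div_le hD0
      (by positivity : 0 ≤ 4 * ((s : ℝ) - n / 2) ^ 2 / n)
    have h4 : 1 - 4 / (n * D) * (((s * d : ℕ) : ℝ) - N / 2) ^ 2
        ≤ 1 - 4 * ((s : ℝ) - n / 2) ^ 2 / n / D := by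
      have e : (((s * d : ℕ) : ℝ) - N / 2) ^ 2 = (d : ℝ) ^ 2 * ((s : ℝ) - n / 2) ^ 2 := by
        rw [hNr]
        push_cast
        ring
      have e2 : 4 * ((s : ℝ) - n / 2) ^ 2 / n / D = 4 / (n * D) * ((s : ℝ) - n / 2) ^ 2 := by
        field_simp
      rw [e, e2]
      -- A crude loss of d^2, so that the deviation can be written in terms of j = sd and N.
      have : ((s : ℝ) - n / 2) ^ 2 ≤ (d : ℝ) ^ 2 * ((s : ℝ) - n / 2) ^ 2 :=
        le_mul_of_one_le_left (sq_nonneg _) (one_le_pow₀ hd')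
      gcongr
    have h5 : √((n : ℝ) + 1) ≤ √((N : ℝ) + 1) := by
      refine Real.sqrt_le_sqrt ?_
      rw [hNr]
      nlinarith
    have h6 : 2 ^ n * (Real.exp (-D) * (1 - 4 / (n * D) * (((s * d : ℕ) : ℝ) - N / 2) ^ 2))
        * N.choose (s * d) ≤ Real.exp 1 ^ 2 * n.choose s * 2 ^ N := by
      calc 2 ^ n * (Real.exp (-D) * (1 - 4 / (n * D) * (((s * d : ℕ) : ℝ) - N / 2) ^ 2))
            * N.choose (s * d)
          ≤ 2 ^ n * (Real.exp (-D) * (1 - 4 * ((s : ℝ) - n / 2) ^ 2 / n / D))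
            * N.choose (s * d) := by gcongr
        _ ≤ 2 ^ n * Real.exp (-(4 * ((s : ℝ) - n / 2) ^ 2 / n)) * N.choose (s * d) := by gcongr
        _ ≤ Real.exp 1 ^ 2 * √((n : ℝ) + 1) * n.choose s * N.choose (s * d) := by gcongr
        _ ≤ Real.exp 1 ^ 2 * √((N : ℝ) + 1) * n.choose s * N.choose (s * d) := by gcongr
        _ = Real.exp 1 ^ 2 * n.choose s * (N.choose (s * d) * √((N : ℝ) + 1)) := by ring
        _ ≤ Real.exp 1 ^ 2 * n.choose s * 2 ^ N := by gcongr
    rw [h, ← mul_div_assoc (n.choose s : ℝ), le_div_iff₀ hpos]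
    calc 2 ^ n / 2 ^ N * (Real.exp (-D) / Real.exp 1 ^ 2)
          * (A (s * d) * (1 - 4 / (n * D) * (((s * d : ℕ) : ℝ) - N / 2) ^ 2)) * N.choose (s * d)
        = A (s * d) / (2 ^ N * Real.exp 1 ^ 2) * (2 ^ n * (Real.exp (-D)
          * (1 - 4 / (n * D) * (((s * d : ℕ) : ℝ) - N / 2) ^ 2)) * N.choose (s * d)) := by
          field_simp
      _ ≤ A (s * d) / (2 ^ N * Real.exp 1 ^ 2) * (Real.exp 1 ^ 2 * n.choose s * 2 ^ N) :=
          mul_le_mul_of_nonneg_left h6 (div_nonneg (hA0 _) (by positivity))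
      _ = n.choose s * A (s * d) := by
          field_simp
  rw [expectedColorings_eq h]
  refine le_trans ?_ (Finset.sum_le_sum hterm)
  rw [← Finset.mul_sum]
  have hmoment := sum_properCount_mul_sub_half_sq_le hK
  have hdvd := pow_le_sum_properCount_dvd hk hd hn h
  rw [← hN, ← hWdef] at hdvd hmoment
  have hsum : W ^ m / W ^ d / 2 ≤ ∑ s ∈ range (n + 1),
      A (s * d) * (1 - 4 / (n * D) * (((s * d : ℕ) : ℝ) - N / 2) ^ 2) := by
    rw [sum_range_mul_eq hd n (fun j => A j * (1 - 4 / (n * D) * ((j : ℝ) - N / 2) ^ 2)), h]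
    have e : ∀ j, A j * (1 - 4 / (n * D) * ((j : ℝ) - N / 2) ^ 2)
        = A j - 4 / (n * D) * (A j * ((j : ℝ) - N / 2) ^ 2) := fun j => by ring
    simp only [e]
    rw [Finset.sum_sub_distrib, ← Finset.mul_sum]
    have h1 : ∑ j ∈ range (N + 1) with d ∣ j, A j * ((j : ℝ) - N / 2) ^ 2
        ≤ K * W ^ m * (N / 4) := by
      refine le_trans ?_ hmoment
      exact Finset.sum_le_sum_of_subset_of_nonneg (Finset.filter_subset _ _)
        fun j _ _ => mul_nonneg (hA0 j) (sq_nonneg _)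
    have h2 : 4 / (n * D) * (∑ j ∈ range (N + 1) with d ∣ j, A j * ((j : ℝ) - N / 2) ^ 2)
        ≤ W ^ m / W ^ d / 2 := by
      refine (mul_le_mul_of_nonneg_left h1 (by positivity)).trans_eq ?_
      rw [hNr, hD]
      field_simp
    have h3 : W ^ m / W ^ d ≤ ∑ j ∈ range (N + 1) with d ∣ j, A j := by
      rw [div_le_iff₀ (by positivity), mul_comm]
      exact hdvd
    linarith
  refine le_trans (le_of_eq ?_) (mul_le_mul_of_nonneg_left hsum (by positivity))
  field_simp

theorem properCount_zero_zero {k : ℕ} (hk : 1 ≤ k) : properCount 0 k 0 = 1 := by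
  have h := coeff_clausePoly_one_pow (m := 0) hk 0
  rw [pow_zero, coeff_one_zero] at h
  exact_mod_cast h.symm

end RegularNAE

theorem mainTheorem4 (k d : ℕ) (hk : 3 ≤ k) :
    ∃ C₁ C₂ : ℝ, 0 < C₁ ∧ 0 < C₂ ∧
      ∀ n m : ℕ, 2 ≤ n → n * d = m * k →
        RegularNAE.expectedNAESolutions n m d k
            = (2 : ℝ) ^ n * (1 - (2 : ℝ) ^ (-(k : ℤ) + 1)) ^ m ∧
          RegularNAE.expectedColorings n m d k / RegularNAE.expectedNAESolutions n m d k
            ∈ Set.Icc C₁ C₂ := by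
  open RegularNAE in
  have hW : (0 : ℝ) < 2 ^ k - 2 := by
    have : (2 : ℝ) ^ 3 ≤ 2 ^ k := pow_le_pow_right₀ one_le_two hk
    linarith
  have hE : ∀ n m : ℕ, n * d = m * k → expectedNAESolutions n m d k
      = 2 ^ n * ((2 ^ k - 2) ^ m / 2 ^ (m * k)) := fun n m h => by
    rw [expectedNAESolutions_eq h, card_isProper (by omega)]
  have hformula : ∀ n m : ℕ, (2 : ℝ) ^ n * ((2 ^ k - 2) ^ m / 2 ^ (m * k))
      = (2 : ℝ) ^ n * (1 - (2 : ℝ) ^ (-(k : ℤ) + 1)) ^ m := fun n m => by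
    rw [zpow_add₀ two_ne_zero, zpow_neg, zpow_natCast, zpow_one, mul_comm m k, pow_mul, ← div_pow]
    congr 2
    field_simp
  rcases Nat.eq_zero_or_pos d with rfl | hd
  -- When d = 0 there are no clauses, so every assignment counts and the ratio is exactly 1.
  · refine ⟨1, 1, one_pos, one_pos, fun n m _ h => ⟨(hE n m h).trans (hformula n m), ?_⟩⟩
    obtain rfl : m = 0 := by
      rcases Nat.mul_eq_zero.1 (h.symm.trans (Nat.mul_zero n)) with h | h <;> omega
    have hs : ∑ s ∈ Finset.range (n + 1), (n.choose s : ℝ) = 2 ^ n := by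
      exact_mod_cast Nat.sum_range_choose n
    rw [hE n 0 h, expectedColorings_eq h]
    simp [properCount_zero_zero (by omega : 1 ≤ k), hs]
  · obtain ⟨K, hK0, hK⟩ := exists_properCount_le hk
    refine ⟨Real.exp (-(2 * K * d * (2 ^ k - 2) ^ d)) / (2 * Real.exp 1 ^ 2 * (2 ^ k - 2) ^ d), K,
      by positivity, hK0, fun n m hn h => ⟨(hE n m h).trans (hformula n m), ?_⟩⟩
    rw [hE n m h, Set.mem_Icc, le_div_iff₀ (by positivity), div_le_iff₀ (by positivity)]
    exact ⟨le_expectedColorings hk hd hn h hK0 (hK m), expectedColorings_le h (hK m)⟩
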